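/- Let $f_0$ be a positive function on $[0,1]^d$. Let $X_1,\dots,X_n$ be (random or deterministic) design points in $[0,1]^d$, and let $Y=(Y_1,\dots,Y_n)^T$ be counts which, conditionally on $X_1,\dots,X_n$, are independent with $Y_i\sim\mathrm{Poisson}(f_0(X_i))$. Write $\mathbb P$ and $\mathbb E$ for probability and expectation conditionally on $X_1,\dots,X_n$. Let $\varphi_1,\dots,\varphi_p$ be real functions on $\mathbb R^d$, let $A=(\varphi_j(X_i))_{1\le i\le n,\,1\le j\le p}$, let $\{1,\dots,p\}=G_1\sqcup\dots\sqcup G_K$ be a partition into non-empty groups, and let $A_{G_k}$ be the submatrix of $A$ with the columns indexed by $G_k$. Fix $k\in\{1,\dots,K\}$ and $\gamma>0$, and assume that there is $M>0$ with $|f_0(x)|\le M$ for all $x\in[0,1]^d$. Assume also that $A_{G_k}\neq 0$. Set $$c_k=\sup_{x\in\mathbb R^n,\ A_{G_k}^Tx\ne 0}\frac{\|A_{G_k}A_{G_k}^Tx\|_2}{\|A_{G_k}^Tx\|_2},\qquad b_k=\max_{1\le i\le n}\sqrt{\sum_{j\in G_k}\varphi_j^2(X_i)},\qquad D_k=8Mc_k^2+16b_k^2\gamma\log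 p,$$ and, for $j\in G_k$, $\widehat V_j=\sum_{i=1}^n\varphi_j^2(X_i)Y_i$ and $$\widetilde V_j^g=\widehat V_j+\sqrt{2(\gamma\log p+\log|G_k|)\,\widehat V_j\max_i\varphi_j^2(X_i)}+3(\gamma\log p+\log|G_k|)\max_i\varphi_j^2(X_i).$$ Finally, let $$\lambda_k^g=\Bigl(1+\frac{1}{2\sqrt{2\gamma\log p}}\Bigr)\sqrt{\sum_{j\in G_k}\widetilde V_j^g}+2\sqrt{\gamma\log p\,D_k}.$$ Then, almost surely with respect to the design, $$\mathbb P\Bigl(\|A_{G_k}^T(Y-\mathbb E[Y])\|_2\ge\lambda_k^g\Bigr)\le\frac{2}{p^\gamma}.$$ (For $p=1$ the weight is undefined or infinite and the bound is trivial.) -/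

import Mathlib

open MeasureTheory ProbabilityTheory
open scoped Matrix

noncomputable section

namespace PoissonGroupLasso

/-- The Euclidean norm of a finite real vector. -/
def l2norm {ι : Type*} [Fintype ι] (v : ι → ℝ) : ℝ := ‖WithLp.toLp 2 v‖

/-- Functional Poisson regression: the design points `X i` lie in `[0,1]^d` almost surely and,
conditionally on the whole design `(X i)`, the counts `Y i` are independent with
`Y i ∼ Poisson (f₀ (X i))`. A deterministic design is the special case of constant `X i`
(then `condDistrib` at the design is the law of `Y`). -/
structure IsPoissonRegression {Ω : Type*} [MeasurableSpace Ω] (P : Measure Ω)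
    [IsProbabilityMeasure P] {n d : ℕ} (f₀ : (Fin d → ℝ) → ℝ)
    (X : Ω → Fin n → Fin d → ℝ) (Y : Ω → Fin n → ℕ) : Prop where
  measurable_design : Measurable X
  measurable_counts : Measurable Y
  mem_cube : ∀ᵐ ω ∂P, ∀ i, X ω i ∈ Set.Icc (0 : Fin d → ℝ) 1
  condLaw : ∀ᵐ x ∂(P.map X),
    condDistrib Y X P x = Measure.pi (fun i => poissonMeasure (f₀ (x i)).toNNReal)

/-- Deterministic designs with independent Poisson counts are covered by the model. -/
theorem IsPoissonRegression.of_fixed {Ω : Type*} [MeasurableSpace Ω] (P : Measure Ω)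
    [IsProbabilityMeasure P] {n d : ℕ} (f₀ : (Fin d → ℝ) → ℝ) (x₀ : Fin n → Fin d → ℝ)
    (hx₀ : ∀ i, x₀ i ∈ Set.Icc (0 : Fin d → ℝ) 1) (Y : Ω → Fin n → ℕ) (hY : Measurable Y)
    (hlaw : P.map Y = Measure.pi (fun i => poissonMeasure (f₀ (x₀ i)).toNNReal)) :
    IsPoissonRegression P f₀ (fun _ => x₀) Y := by
  refine ⟨measurable_const, hY, .of_forall fun _ => hx₀, ?_⟩
  have h : condDistrib Y (fun _ => x₀) P x₀ = P.map Y := by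
    ext s hs
    rw [condDistrib_apply_of_ne_zero hY _ (by simp [Measure.map_const]),
      Measure.map_apply (by fun_prop) ((measurableSet_singleton _).prod hs),
      Measure.map_apply hY hs]
    simp [Measure.map_const, Set.mk_preimage_prod]
  rw [Measure.map_const]
  simp [ae_dirac_eq, h, hlaw]

/-- The `n × p` design matrix `A i j = φ j (x i)`. -/
def designMatrix {n d p : ℕ} (φ : Fin p → (Fin d → ℝ) → ℝ) (x : Fin n → Fin d → ℝ) :
    Matrix (Fin n) (Fin p) ℝ :=
  Matrix.of fun i j => φ j (x i)

/-- The submatrix `A_G` of the columns of `A` indexed by `G`. -/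
def groupMatrix {n p : ℕ} (A : Matrix (Fin n) (Fin p) ℝ) (G : Finset (Fin p)) :
    Matrix (Fin n) G ℝ :=
  A.submatrix id (fun j => (j : Fin p))

/-- `c = sup_v ‖A_G A_Gᵀ v‖₂ / ‖A_Gᵀ v‖₂`, over the `v` for which the quotient makes sense. -/
def cConst {n p : ℕ} (A : Matrix (Fin n) (Fin p) ℝ) (G : Finset (Fin p)) : ℝ :=
  sSup ((fun v : Fin n → ℝ =>
      l2norm ((groupMatrix A G * (groupMatrix A G)ᵀ) *ᵥ v) / l2norm ((groupMatrix A G)ᵀ *ᵥ v)) ''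
    {v | (groupMatrix A G)ᵀ *ᵥ v ≠ 0})

/-- `b = max_i √(∑_{j ∈ G} A i j ^ 2)`. -/
def bConst {n p : ℕ} (A : Matrix (Fin n) (Fin p) ℝ) (G : Finset (Fin p)) : ℝ :=
  ⨆ i : Fin n, √(∑ j ∈ G, A i j ^ 2)

/-- The unbiased variance estimate `V̂ j = ∑_i A i j ^ 2 * Y i`. -/
def varHat {n p : ℕ} (A : Matrix (Fin n) (Fin p) ℝ) (y : Fin n → ℕ) (j : Fin p) : ℝ :=
  ∑ i, A i j ^ 2 * (y i : ℝ)

/-- The inflated variance estimate `Ṽ j ^ g`, with `u = γ log p + log |G|`. -/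
def varTilde {n p : ℕ} (A : Matrix (Fin n) (Fin p) ℝ) (G : Finset (Fin p)) (γ : ℝ)
    (y : Fin n → ℕ) (j : Fin p) : ℝ :=
  varHat A y j
    + √(2 * (γ * Real.log p + Real.log G.card) * varHat A y j * ⨆ i : Fin n, A i j ^ 2)
    + 3 * (γ * Real.log p + Real.log G.card) * ⨆ i : Fin n, A i j ^ 2

/-- `D = 8 M c² + 16 b² γ log p`. -/
def dConst {n p : ℕ} (A : Matrix (Fin n) (Fin p) ℝ) (G : Finset (Fin p)) (M γ : ℝ) : ℝ :=
  8 * M * cConst A G ^ 2 + 16 * bConst A G ^ 2 * γ * Real.log p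

/-- The data-driven group weight `λ ^ g`, computed from the observed counts `y`. -/
def groupWeight {n p : ℕ} (A : Matrix (Fin n) (Fin p) ℝ) (G : Finset (Fin p)) (M γ : ℝ)
    (y : Fin n → ℕ) : ℝ :=
  (1 + 1 / (2 * √(2 * γ * Real.log p))) * √(∑ j ∈ G, varTilde A G γ y j)
    + 2 * √(γ * Real.log p * dConst A G M γ)

/-- The mean vector of a law of counts. -/
def meanVec {n : ℕ} (Q : Measure (Fin n → ℕ)) (i : Fin n) : ℝ := ∫ y, (y i : ℝ) ∂Q

end PoissonGroupLasso

end

/-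
Write `Dᵢ F (y) = F (y + eᵢ) - F y` for a vector `y` of independent Poisson counts with rates `θᵢ`,
and `B` for the Bregman divergence of `x ↦ x log x`. The Mecke identity
`E [yᵢ F y] = θᵢ E [F (y + eᵢ)]`, used with the reference value `g 0`, gives
`Ent g ≤ ∑ᵢ θᵢ E [B (g (y + eᵢ)) (g y)]` up to an error quadratic in the rates. Defects add up
under convolution, so splitting `θ` into `N` equal parts leaves an error `O(1 / N)`, and `N → ∞`
removes it. Herbst's argument then bounds the upward deviations of any `F` with `Dᵢ F` bounded above
and `∑ᵢ θᵢ (Dᵢ F)²` bounded. The norm of the score is truncated from below at a multiple of its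
standard deviation `√V`, which keeps its discrete gradient bounded and produces the factor
`1 + 1 / (2 √(2 γ log p))` in front of `√V`. Finally `V` is replaced by its inflated estimate,
through a Chernoff bound on the lower tail of each `V̂ j` and a union bound over the group.
-/

namespace PoissonGroupLasso

open Filter Topology
open scoped NNReal

/-- The Bregman divergence of `x ↦ x log x`, the integrand of the modified logarithmic Sobolev
inequality. -/
noncomputable def bregman (a b : ℝ) : ℝ := a * (Real.log a - Real.log b) - a + b

/-- The entropy functional `Ent_μ g` of a positive function. -/
noncomputable def entropy {α : Type*} [MeasurableSpace α] (μ : Measure α) (g : α → ℝ) : ℝ :=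
  ∫ x, g x * Real.log (g x) ∂μ - (∫ x, g x ∂μ) * Real.log (∫ x, g x ∂μ)

theorem le_bregman {a b c : ℝ} (ha : 0 ≤ a) (hb : 0 < b) (hc : 0 < c) :
    a * Real.log c - b * c + b ≤ bregman a b := by
  rcases ha.eq_or_lt with rfl | ha
  · simp [bregman, (mul_pos hb hc).le]
  have h := mul_le_mul_of_nonneg_left
    (Real.log_le_sub_one_of_pos (x := b * c / a) (by positivity)) ha.le
  rw [Real.log_div (by positivity) ha.ne', Real.log_mul hb.ne' hc.ne',
    mul_sub a (b * c / a), mul_div_cancel₀ _ ha.ne'] at h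
  unfold bregman
  linarith

theorem bregman_nonneg {a b : ℝ} (ha : 0 ≤ a) (hb : 0 < b) : 0 ≤ bregman a b := by
  simpa using le_bregman ha hb one_pos

theorem bregman_self (a : ℝ) : bregman a a = 0 := by simp [bregman]

theorem bregman_mem_Icc {m C a b : ℝ} (hm : 0 < m) (ha : a ∈ Set.Icc m C)
    (hb : b ∈ Set.Icc m C) :
    bregman a b ∈ Set.Icc 0 (C * (Real.log C - Real.log m) + C) := by
  have ha0 := hm.trans_le ha.1
  have hb0 := hm.trans_le hb.1
  refine ⟨bregman_nonneg ha0.le hb0, ?_⟩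
  have hlog : Real.log a - Real.log b ≤ Real.log C - Real.log m :=
    sub_le_sub (Real.log_le_log ha0 ha.2) (Real.log_le_log hm hb.1)
  have hlog0 : 0 ≤ Real.log C - Real.log m :=
    sub_nonneg.2 (Real.log_le_log hm (ha.1.trans ha.2))
  have hmul : a * (Real.log a - Real.log b) ≤ C * (Real.log C - Real.log m) :=
    (mul_le_mul_of_nonneg_left hlog ha0.le).trans (mul_le_mul_of_nonneg_right ha.2 hlog0)
  unfold bregman
  linarith [hb.2]

theorem bregman_exp (s t : ℝ) :
    bregman (Real.exp s) (Real.exp t) =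
      Real.exp t * ((s - t) * Real.exp (s - t) - Real.exp (s - t) + 1) := by
  have hst : Real.exp s = Real.exp t * Real.exp (s - t) := by
    rw [← Real.exp_add, add_sub_cancel]
  unfold bregman
  rw [Real.log_exp, Real.log_exp, hst]
  ring

theorem bregman_exp_le {s t : ℝ} (hst : s - t ≤ 1) :
    bregman (Real.exp s) (Real.exp t) ≤ Real.exp t * (s - t) ^ 2 := by
  rw [bregman_exp]
  refine mul_le_mul_of_nonneg_left ?_ (Real.exp_pos t).le
  nlinarith [Real.add_one_le_exp (s - t)]

theorem mul_log_mem_Icc {m C a : ℝ} (hm : 0 < m) (ha : a ∈ Set.Icc m C) :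
    a * Real.log a ∈ Set.Icc (-1) (C * C) := by
  have ha0 := hm.trans_le ha.1
  constructor
  · have h := bregman_nonneg ha0.le one_pos
    simp only [bregman, Real.log_one, sub_zero] at h
    linarith
  · calc a * Real.log a ≤ a * C :=
          mul_le_mul_of_nonneg_left ((Real.log_le_self ha0.le).trans ha.2) ha0.le
      _ ≤ C * C := mul_le_mul_of_nonneg_right ha.2 (ha0.le.trans ha.2)

theorem entropy_le_integral_bregman {α : Type*} [MeasurableSpace α] {μ : Measure α}
    [IsProbabilityMeasure μ] {g : α → ℝ} {c : ℝ} (hg0 : ∀ x, 0 ≤ g x) (hg : Integrable g μ)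
    (hlog : Integrable (fun x => g x * Real.log (g x)) μ) (hc : 0 < c) :
    entropy μ g ≤ ∫ x, bregman (g x) c ∂μ := by
  have hsplit : ∫ x, bregman (g x) c ∂μ =
      ∫ x, g x * Real.log (g x) ∂μ - (∫ x, g x ∂μ) * Real.log c - ∫ x, g x ∂μ + c := by
    have hlogc : Integrable (fun x => g x * Real.log c) μ := hg.mul_const _
    simp only [bregman, mul_sub]
    rw [integral_add (f := fun x => g x * Real.log (g x) - g x * Real.log c - g x)
        ((hlog.sub hlogc).sub hg) (integrable_const _),
      integral_sub (f := fun x => g x * Real.log (g x) - g x * Real.log c) (hlog.sub hlogc) hg,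
      integral_sub hlog hlogc, integral_mul_const, integral_const, probReal_univ, one_smul]
  have hnonneg : 0 ≤ bregman (∫ x, g x ∂μ) c := bregman_nonneg (integral_nonneg hg0) hc
  rw [hsplit]
  unfold bregman at hnonneg
  unfold entropy
  linarith

section Discrete

variable {α : Type*} [MeasurableSpace α] [DiscreteMeasurableSpace α] {m C : ℝ}

theorem integrable_of_mem_Icc (μ : Measure α) [IsFiniteMeasure μ] {g : α → ℝ}
    (hg : ∀ x, g x ∈ Set.Icc m C) : Integrable g μ :=
  .of_mem_Icc m C Measurable.of_discrete.aemeasurable (.of_forall hg)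

theorem integral_mem_Icc (μ : Measure α) [IsProbabilityMeasure μ] {g : α → ℝ}
    (hg : ∀ x, g x ∈ Set.Icc m C) : ∫ x, g x ∂μ ∈ Set.Icc m C :=
  (convex_Icc m C).integral_mem isClosed_Icc (.of_forall hg) (integrable_of_mem_Icc μ hg)

theorem integrable_mul_log (μ : Measure α) [IsFiniteMeasure μ] {g : α → ℝ} (hm : 0 < m)
    (hg : ∀ x, g x ∈ Set.Icc m C) : Integrable (fun x => g x * Real.log (g x)) μ :=
  integrable_of_mem_Icc μ fun x => mul_log_mem_Icc hm (hg x)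

theorem integrable_bregman (μ : Measure α) [IsFiniteMeasure μ] {g k : α → ℝ} (hm : 0 < m)
    (hg : ∀ x, g x ∈ Set.Icc m C) (hk : ∀ x, k x ∈ Set.Icc m C) :
    Integrable (fun x => bregman (g x) (k x)) μ :=
  integrable_of_mem_Icc μ fun x => bregman_mem_Icc hm (hg x) (hk x)

theorem integrable_entropy {β : Type*} [MeasurableSpace β] [DiscreteMeasurableSpace β]
    (μ : Measure α) [IsProbabilityMeasure μ] (ν : Measure β) [IsProbabilityMeasure ν]
    {g : α → β → ℝ} (hm : 0 < m) (hg : ∀ x y, g x y ∈ Set.Icc m C) :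
    Integrable (fun x => entropy ν (g x)) μ :=
  (integrable_of_mem_Icc μ fun x => integral_mem_Icc ν fun y => mul_log_mem_Icc hm (hg x y)).sub
    (integrable_mul_log μ hm fun x => integral_mem_Icc ν (hg x))

theorem bregman_integral_le (μ : Measure α) [IsProbabilityMeasure μ] {g k : α → ℝ} (hm : 0 < m)
    (hg : ∀ x, g x ∈ Set.Icc m C) (hk : ∀ x, k x ∈ Set.Icc m C) :
    bregman (∫ x, g x ∂μ) (∫ x, k x ∂μ) ≤ ∫ x, bregman (g x) (k x) ∂μ := by
  have ha : 0 < ∫ x, g x ∂μ := hm.trans_le (integral_mem_Icc μ hg).1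
  have hb : 0 < ∫ x, k x ∂μ := hm.trans_le (integral_mem_Icc μ hk).1
  set a := ∫ x, g x ∂μ
  set b := ∫ x, k x ∂μ
  have hga : Integrable (fun x => g x * Real.log (a / b)) μ :=
    (integrable_of_mem_Icc μ hg).mul_const _
  have hkb : Integrable (fun x => k x * (a / b)) μ := (integrable_of_mem_Icc μ hk).mul_const _
  have hkint := integrable_of_mem_Icc μ hk
  calc bregman a b = a * Real.log (a / b) - b * (a / b) + b := by
        rw [Real.log_div ha.ne' hb.ne', mul_div_cancel₀ _ hb.ne', bregman]
    _ = ∫ x, (g x * Real.log (a / b) - k x * (a / b) + k x) ∂μ := by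
        rw [integral_add (f := fun x => g x * Real.log (a / b) - k x * (a / b)) (hga.sub hkb) hkint,
          integral_sub hga hkb, integral_mul_const, integral_mul_const]
    _ ≤ ∫ x, bregman (g x) (k x) ∂μ :=
        integral_mono ((hga.sub hkb).add hkint) (integrable_bregman μ hm hg hk) fun x =>
          le_bregman (hm.trans_le (hg x).1).le (hm.trans_le (hk x).1) (div_pos ha hb)

end Discrete

section Convolution

variable {α ι : Type*} [AddCommMonoid α] [Countable α] [MeasurableSpace α]
  [DiscreteMeasurableSpace α] {μ ν : Measure α} [IsProbabilityMeasure μ] [IsProbabilityMeasure ν]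
  {m C : ℝ}

theorem entropy_conv {g : α → ℝ} (hm : 0 < m) (hg : ∀ x, g x ∈ Set.Icc m C) :
    entropy (μ ∗ ν) g =
      entropy μ (fun x => ∫ y, g (x + y) ∂ν) + ∫ x, entropy ν (fun y => g (x + y)) ∂μ := by
  have hP : ∀ x, ∫ y, g (x + y) ∂ν ∈ Set.Icc m C := fun _ => integral_mem_Icc ν fun _ => hg _
  have hint : Integrable (fun x => ∫ y, g (x + y) * Real.log (g (x + y)) ∂ν) μ :=
    integrable_of_mem_Icc μ fun _ => integral_mem_Icc ν fun _ => mul_log_mem_Icc hm (hg _)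
  unfold entropy
  rw [integral_conv (integrable_of_mem_Icc _ hg), integral_conv (integrable_mul_log _ hm hg),
    integral_sub hint (integrable_mul_log μ hm hP)]
  ring

variable [Fintype ι]

/-- The modified logarithmic Sobolev inequality with jumps `a i` at rates `θ i`, up to an additive
defect `δ`, for functions with values in `[m, C]`. Keeping the defect lets the inequality be
accumulated over convolution powers. -/
def HasModLogSobolev (μ : Measure α) (a : ι → α) (θ : ι → ℝ≥0) (m C δ : ℝ) : Prop :=
  ∀ g : α → ℝ, (∀ x, g x ∈ Set.Icc m C) →
    entropy μ g ≤ ∑ i, θ i * ∫ x, bregman (g (x + a i)) (g x) ∂μ + δ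

theorem HasModLogSobolev.conv {a : ι → α} {θ θ' : ι → ℝ≥0} {δ δ' : ℝ} (hm : 0 < m)
    (hμ : HasModLogSobolev μ a θ m C δ) (hν : HasModLogSobolev ν a θ' m C δ') :
    HasModLogSobolev (μ ∗ ν) a (θ + θ') m C (δ + δ') := by
  intro g hg
  let E : ι → α → ℝ := fun i x => ∫ y, bregman (g (x + y + a i)) (g (x + y)) ∂ν
  have hE : ∀ i, Integrable (E i) μ := fun i =>
    integrable_of_mem_Icc μ fun _ => integral_mem_Icc ν fun _ => bregman_mem_Icc hm (hg _) (hg _)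
  have hconv : ∀ i, ∫ x, bregman (g (x + a i)) (g x) ∂(μ ∗ ν) = ∫ x, E i x ∂μ := fun i =>
    integral_conv (integrable_bregman _ hm (fun _ => hg _) hg)
  have hP : ∀ x, ∫ y, g (x + y) ∂ν ∈ Set.Icc m C := fun _ => integral_mem_Icc ν fun _ => hg _
  have hjensen : ∀ i,
      ∫ x, bregman (∫ y, g (x + a i + y) ∂ν) (∫ y, g (x + y) ∂ν) ∂μ ≤ ∫ x, E i x ∂μ := fun i =>
    integral_mono (integrable_bregman μ hm (fun _ => hP _) hP) (hE i) fun x => by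
      simp only [add_right_comm x (a i)]
      exact bregman_integral_le ν hm (fun _ => hg _) fun _ => hg _
  have houter : entropy μ (fun x => ∫ y, g (x + y) ∂ν) ≤ ∑ i, θ i * ∫ x, E i x ∂μ + δ :=
    (hμ _ hP).trans <| add_le_add_left (Finset.sum_le_sum fun i _ =>
      mul_le_mul_of_nonneg_left (hjensen i) (θ i).coe_nonneg) δ
  have hinner : ∫ x, entropy ν (fun y => g (x + y)) ∂μ ≤ ∑ i, θ' i * ∫ x, E i x ∂μ + δ' := by
    have hsum : Integrable (fun x => ∑ i, θ' i * E i x) μ :=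
      integrable_finsetSum _ fun i _ => (hE i).const_mul _
    calc ∫ x, entropy ν (fun y => g (x + y)) ∂μ ≤ ∫ x, (∑ i, θ' i * E i x + δ') ∂μ := by
          refine integral_mono (integrable_entropy μ ν hm fun _ _ => hg _)
            (hsum.add (integrable_const _)) fun x => ?_
          simpa only [E, add_assoc] using hν (fun y => g (x + y)) fun _ => hg _
      _ = ∑ i, θ' i * ∫ x, E i x ∂μ + δ' := by
          rw [integral_add hsum (integrable_const _),
            integral_finsetSum _ fun i _ => (hE i).const_mul _]
          simp only [integral_const_mul, integral_const, probReal_univ, one_smul]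
  rw [entropy_conv hm hg]
  simp only [hconv, Pi.add_apply, NNReal.coe_add, add_mul, Finset.sum_add_distrib]
  linarith

end Convolution

section PoissonVector

variable {ι : Type*} [Fintype ι]

/-- The law of a vector of independent Poisson counts with rates `θ i`. -/
noncomputable abbrev poissonPi (θ : ι → ℝ≥0) : Measure (ι → ℕ) :=
  Measure.pi fun i => poissonMeasure (θ i)

theorem poissonPi_conv (θ θ' : ι → ℝ≥0) :
    poissonPi θ ∗ poissonPi θ' = poissonPi (θ + θ') := by
  have hprod := measurePreserving_arrowProdEquivProdArrow ℕ ℕ ι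
    (fun i => poissonMeasure (θ i)) fun i => poissonMeasure (θ' i)
  calc poissonPi θ ∗ poissonPi θ'
      = (Measure.pi fun i => (poissonMeasure (θ i)).prod (poissonMeasure (θ' i))).map
          fun z i => (z i).1 + (z i).2 := by
        rw [Measure.conv, ← hprod.map_eq, Measure.map_map .of_discrete hprod.measurable]
        rfl
    _ = poissonPi (θ + θ') := by
        rw [Measure.pi_map_pi (X := fun _ => ℕ × ℕ) (f := fun _ z => z.1 + z.2)
          fun _ => Measurable.of_discrete.aemeasurable]
        congr with i : 1
        exact poissonMeasure_conv_poissonMeasure _ _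

theorem poissonMeasure_singleton_succ (r : ℝ≥0) (k : ℕ) :
    poissonMeasure r {k + 1} * (k + 1 : ℕ) = r * poissonMeasure r {k} := by
  rw [poissonMeasure_singleton, poissonMeasure_singleton, ← ENNReal.ofReal_natCast,
    ← ENNReal.ofReal_coe_nnreal, ← ENNReal.ofReal_mul (by positivity),
    ← ENNReal.ofReal_mul (by positivity), Nat.factorial_succ]
  congr 1
  push_cast
  field_simp
  ring

theorem one_le_sum_natCast_of_ne_zero {y : ι → ℕ} (hy : y ≠ 0) : 1 ≤ ∑ i, (y i : ℝ) := by
  obtain ⟨i, hi⟩ := Function.ne_iff.1 hy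
  calc (1 : ℝ) ≤ y i := Nat.one_le_cast.2 (Nat.one_le_iff_ne_zero.2 hi)
    _ ≤ ∑ i, (y i : ℝ) :=
      Finset.single_le_sum (f := fun i => (y i : ℝ)) (fun _ _ => Nat.cast_nonneg _)
        (Finset.mem_univ i)

theorem poissonPi_singleton_add_single [DecidableEq ι] (θ : ι → ℝ≥0) (x : ι → ℕ) (i : ι) :
    poissonPi θ {x + Pi.single i 1} * (x i + 1 : ℕ) = θ i * poissonPi θ {x} := by
  have hne : ∀ l ∈ Finset.univ.erase i,
      poissonMeasure (θ l) {(x + Pi.single i 1 : ι → ℕ) l} = poissonMeasure (θ l) {x l} :=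
    fun l hl => by simp [Finset.ne_of_mem_erase hl]
  have hi : (x + Pi.single i 1 : ι → ℕ) i = x i + 1 := by simp
  rw [Measure.pi_singleton, Measure.pi_singleton, ← Finset.mul_prod_erase _ _ (Finset.mem_univ i),
    Finset.prod_congr rfl hne, hi, mul_right_comm, poissonMeasure_singleton_succ, mul_assoc,
    Finset.mul_prod_erase _ (fun l => poissonMeasure (θ l) {x l}) (Finset.mem_univ i)]

theorem withDensity_eval_poissonPi [DecidableEq ι] (θ : ι → ℝ≥0) (i : ι) :
    (poissonPi θ).withDensity (fun y => ((y i : ℝ≥0) : ENNReal)) =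
      θ i • (poissonPi θ).map (· + Pi.single i 1) := by
  refine Measure.ext_of_singleton fun y => ?_
  rw [withDensity_apply _ (measurableSet_singleton y), lintegral_singleton, Measure.smul_apply,
    Measure.map_apply .of_discrete (measurableSet_singleton y)]
  rcases Nat.eq_zero_or_pos (y i) with hy | hy
  · have hempty : (· + Pi.single i 1) ⁻¹' {y} = (∅ : Set (ι → ℕ)) := by
      refine Set.eq_empty_of_forall_notMem fun x hx => ?_
      have hxi := congrFun (Set.mem_singleton_iff.1 hx) i
      simp [hy] at hxi
    simp [hempty, hy]
  · obtain ⟨x, rfl⟩ : ∃ x, x + Pi.single i 1 = y :=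
      ⟨y - Pi.single i 1, tsub_add_cancel_of_le fun l => by
        by_cases hl : l = i <;> aesop⟩
    have hpre : (· + Pi.single i 1) ⁻¹' {x + Pi.single i 1} = {x} := by ext; simp
    rw [hpre, ENNReal.smul_def, smul_eq_mul, ← poissonPi_singleton_add_single, mul_comm]
    simp

variable (θ : ι → ℝ≥0)

theorem integrable_eval_mul_poissonPi [DecidableEq ι] {f : (ι → ℕ) → ℝ} (i : ι)
    (hf : Integrable (fun y => f (y + Pi.single i 1)) (poissonPi θ)) :
    Integrable (fun y => (y i : ℝ) * f y) (poissonPi θ) := by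
  have h : Integrable f ((poissonPi θ).withDensity fun y => ((y i : ℝ≥0) : ENNReal)) := by
    rw [withDensity_eval_poissonPi]
    exact ((integrable_map_measure .of_discrete Measurable.of_discrete.aemeasurable).2
      hf).smul_measure_nnreal
  simpa [NNReal.smul_def] using
    (integrable_withDensity_iff_integrable_smul
      (f := fun y : ι → ℕ => (y i : ℝ≥0)) .of_discrete).1 h

theorem integral_eval_mul_poissonPi [DecidableEq ι] (f : (ι → ℕ) → ℝ) (i : ι) :
    ∫ y, (y i : ℝ) * f y ∂(poissonPi θ) = θ i * ∫ y, f (y + Pi.single i 1) ∂(poissonPi θ) := by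
  have h := integral_withDensity_eq_integral_smul (μ := poissonPi θ)
    (f := fun y : ι → ℕ => (y i : ℝ≥0)) .of_discrete f
  rw [withDensity_eval_poissonPi, integral_smul_nnreal_measure,
    integral_map Measurable.of_discrete.aemeasurable .of_discrete] at h
  simpa [NNReal.smul_def] using h.symm

theorem integrable_eval_poissonPi (i : ι) :
    Integrable (fun y : ι → ℕ => (y i : ℝ)) (poissonPi θ) := by
  classical simpa using integrable_eval_mul_poissonPi θ (f := fun _ => 1) i (integrable_const _)

theorem integral_eval_poissonPi (i : ι) : ∫ y, (y i : ℝ) ∂(poissonPi θ) = θ i := by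
  classical simpa using integral_eval_mul_poissonPi θ (fun _ => 1) i

theorem integral_bregman_zero_le {m C K : ℝ} {g : (ι → ℕ) → ℝ} (hm : 0 < m)
    (hg : ∀ y, g y ∈ Set.Icc m C) (hK : ∀ a ∈ Set.Icc m C, ∀ b ∈ Set.Icc m C, bregman a b ≤ K)
    (z : ι → ℕ) :
    ∫ y, bregman (g (y + z)) (g 0) ∂(poissonPi θ) ≤
      ∫ y, bregman (g (y + z)) (g y) ∂(poissonPi θ) + K * ∑ j, (θ j : ℝ) := by
  have hint : ∀ k : (ι → ℕ) → ι → ℕ,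
      Integrable (fun y => bregman (g (y + z)) (g (k y))) (poissonPi θ) := fun k =>
    integrable_bregman _ hm (fun _ => hg _) fun _ => hg _
  have hB0 : ∀ x y, 0 ≤ bregman (g x) (g y) := fun x y => (bregman_mem_Icc hm (hg x) (hg y)).1
  have hcompare : ∀ y, bregman (g (y + z)) (g 0) ≤
      bregman (g (y + z)) (g y) + K * ∑ j, (y j : ℝ) := fun y => by
    rcases eq_or_ne y 0 with rfl | hy
    · simp
    · have hK' := hK _ (hg (y + z)) _ (hg 0)
      calc bregman (g (y + z)) (g 0) ≤ K := hK'
        _ ≤ K * ∑ j, (y j : ℝ) :=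
          le_mul_of_one_le_right ((hB0 _ _).trans hK') (one_le_sum_natCast_of_ne_zero hy)
        _ ≤ _ := le_add_of_nonneg_left (hB0 _ _)
  have hmean : Integrable (fun y : ι → ℕ => K * ∑ j, (y j : ℝ)) (poissonPi θ) :=
    (integrable_finsetSum _ fun j _ => integrable_eval_poissonPi θ j).const_mul K
  calc ∫ y, bregman (g (y + z)) (g 0) ∂(poissonPi θ)
      ≤ ∫ y, (bregman (g (y + z)) (g y) + K * ∑ j, (y j : ℝ)) ∂(poissonPi θ) :=
        integral_mono (hint fun _ => 0) ((hint id).add hmean) hcompare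
    _ = ∫ y, bregman (g (y + z)) (g y) ∂(poissonPi θ) + K * ∑ j, (θ j : ℝ) := by
        rw [integral_add (hint fun y => y) hmean, integral_const_mul,
          integral_finsetSum _ fun j _ => integrable_eval_poissonPi θ j]
        simp only [integral_eval_poissonPi]

variable [DecidableEq ι]

-- A Poisson vector with small rates is `0` or a unit vector up to second order, so `g 0` can serve
-- as the reference value for the entropy.
theorem entropy_poissonPi_le_sum_integral_bregman_zero {m C : ℝ} {g : (ι → ℕ) → ℝ} (hm : 0 < m)
    (hg : ∀ y, g y ∈ Set.Icc m C) :
    entropy (poissonPi θ) g ≤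
      ∑ i, θ i * ∫ y, bregman (g (y + Pi.single i 1)) (g 0) ∂(poissonPi θ) := by
  have hint : ∀ k : (ι → ℕ) → ι → ℕ,
      Integrable (fun y => bregman (g (k y)) (g 0)) (poissonPi θ) := fun k =>
    integrable_bregman _ hm (fun _ => hg _) fun _ => hg _
  have hmul : ∀ i, Integrable (fun y => (y i : ℝ) * bregman (g y) (g 0)) (poissonPi θ) :=
    fun i => integrable_eval_mul_poissonPi θ i (hint _)
  have hjump : ∀ y, bregman (g y) (g 0) ≤ ∑ i, (y i : ℝ) * bregman (g y) (g 0) := fun y => by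
    rw [← Finset.sum_mul]
    rcases eq_or_ne y 0 with rfl | hy
    · simp [bregman_self]
    · exact le_mul_of_one_le_left (bregman_mem_Icc hm (hg y) (hg 0)).1
        (one_le_sum_natCast_of_ne_zero hy)
  calc entropy (poissonPi θ) g ≤ ∫ y, bregman (g y) (g 0) ∂(poissonPi θ) :=
        entropy_le_integral_bregman (fun y => (hm.trans_le (hg y).1).le)
          (integrable_of_mem_Icc _ hg) (integrable_mul_log _ hm hg) (hm.trans_le (hg 0).1)
    _ ≤ ∫ y, ∑ i, (y i : ℝ) * bregman (g y) (g 0) ∂(poissonPi θ) :=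
        integral_mono (hint id) (integrable_finsetSum _ fun i _ => hmul i) hjump
    _ = ∑ i, θ i * ∫ y, bregman (g (y + Pi.single i 1)) (g 0) ∂(poissonPi θ) := by
        rw [integral_finsetSum _ fun i _ => hmul i]
        simp only [integral_eval_mul_poissonPi θ fun y => bregman (g y) (g 0)]

theorem hasModLogSobolev_poissonPi_of_bregman_le {m C K : ℝ} (hm : 0 < m)
    (hK : ∀ a ∈ Set.Icc m C, ∀ b ∈ Set.Icc m C, bregman a b ≤ K) :
    HasModLogSobolev (poissonPi θ) (fun i => Pi.single i 1) θ m C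
      (K * (∑ i, (θ i : ℝ)) ^ 2) := by
  intro g hg
  refine (entropy_poissonPi_le_sum_integral_bregman_zero θ hm hg).trans ?_
  refine (Finset.sum_le_sum fun i _ => mul_le_mul_of_nonneg_left
    (integral_bregman_zero_le θ hm hg hK (Pi.single i 1)) (θ i).coe_nonneg).trans_eq ?_
  simp only [mul_add, Finset.sum_add_distrib, ← Finset.sum_mul]
  ring

theorem hasModLogSobolev_poissonPi_nsmul {m C K : ℝ} (hm : 0 < m)
    (hK : ∀ a ∈ Set.Icc m C, ∀ b ∈ Set.Icc m C, bregman a b ≤ K) (N : ℕ) :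
    HasModLogSobolev (poissonPi ((N + 1) • θ)) (fun i => Pi.single i 1) ((N + 1) • θ) m C
      ((N + 1) * (K * (∑ i, (θ i : ℝ)) ^ 2)) := by
  induction N with
  | zero => simpa using hasModLogSobolev_poissonPi_of_bregman_le θ hm hK
  | succ N ih =>
    have h := ih.conv hm (hasModLogSobolev_poissonPi_of_bregman_le θ hm hK)
    rw [poissonPi_conv, ← succ_nsmul] at h
    convert h using 1
    push_cast
    ring

theorem hasModLogSobolev_poissonPi {m C : ℝ} (hm : 0 < m) :
    HasModLogSobolev (poissonPi θ) (fun i => Pi.single i 1) θ m C 0 := by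
  intro g hg
  obtain ⟨K, hK⟩ : ∃ K, ∀ a ∈ Set.Icc m C, ∀ b ∈ Set.Icc m C, bregman a b ≤ K :=
    ⟨_, fun _ ha _ hb => (bregman_mem_Icc hm ha hb).2⟩
  set Q := ∑ i, θ i * ∫ y, bregman (g (y + Pi.single i 1)) (g y) ∂(poissonPi θ)
  have hsplit : ∀ N : ℕ,
      entropy (poissonPi θ) g ≤ Q + 1 / ((N : ℝ) + 1) * (K * (∑ i, (θ i : ℝ)) ^ 2) := by
    intro N
    have hθ : (N + 1) • ((N + 1 : ℝ≥0)⁻¹ • θ) = θ := by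
      rw [← Nat.cast_smul_eq_nsmul ℝ≥0, smul_smul, Nat.cast_add_one,
        mul_inv_cancel₀ (by positivity), one_smul]
    have h := hasModLogSobolev_poissonPi_nsmul ((N + 1 : ℝ≥0)⁻¹ • θ) hm hK N
    rw [hθ] at h
    convert h g hg using 2
    simp only [Pi.smul_apply, smul_eq_mul, NNReal.coe_mul, ← Finset.mul_sum]
    push_cast
    field_simp
  have hlim : Tendsto (fun N : ℕ => Q + 1 / ((N : ℝ) + 1) * (K * (∑ i, (θ i : ℝ)) ^ 2)) atTop
      (𝓝 (Q + 0 * (K * (∑ i, (θ i : ℝ)) ^ 2))) :=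
    (tendsto_one_div_add_atTop_nhds_zero_nat.mul_const _).const_add _
  rw [zero_mul] at hlim
  exact ge_of_tendsto' hlim hsplit

end PoissonVector

section Herbst

theorem le_of_mul_deriv_sub_le {f : ℝ → ℝ} {D Λ : ℝ}
    (hf : ∀ t ∈ Set.Icc 0 Λ, DifferentiableAt ℝ f t) (h0 : f 0 = 0) (hΛ : 0 < Λ)
    (hD : ∀ t ∈ Set.Ioc 0 Λ, t * deriv f t - f t ≤ t ^ 2 * D) :
    f Λ ≤ Λ * deriv f 0 + Λ ^ 2 * D := by
  have hslope : ∀ t, t ≠ 0 → dslope f 0 t = f t / t := fun t ht => by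
    rw [dslope_of_ne _ ht, slope_def_field, h0, sub_zero, sub_zero]
  have hanti : AntitoneOn (fun t => dslope f 0 t - D * t) (Set.Icc 0 Λ) := by
    refine antitoneOn_of_hasDerivWithinAt_nonpos
      (f' := fun t => (deriv f t * t - f t * 1) / t ^ 2 - D * 1) (convex_Icc 0 Λ) ?_ ?_ ?_
    · refine ContinuousOn.sub (fun t ht => ?_) (by fun_prop)
      rcases eq_or_ne t 0 with rfl | ht0
      · exact (continuousAt_dslope_same.2 (hf 0 ht)).continuousWithinAt
      · exact ((continuousAt_dslope_of_ne ht0).2 (hf t ht).continuousAt).continuousWithinAt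
    · rw [interior_Icc]
      intro t ht
      refine HasDerivAt.hasDerivWithinAt <| HasDerivAt.sub ?_ ((hasDerivAt_id t).const_mul D)
      refine ((hf t ⟨ht.1.le, ht.2.le⟩).hasDerivAt.div (hasDerivAt_id t)
        ht.1.ne').congr_of_eventuallyEq ?_
      filter_upwards [isOpen_ne.mem_nhds ht.1.ne'] with s hs using hslope s hs
    · rw [interior_Icc]
      intro t ht
      have h := hD t ⟨ht.1, ht.2.le⟩
      rw [sub_nonpos, div_le_iff₀ (pow_pos ht.1 2)]
      linarith
  have h := hanti (Set.left_mem_Icc.2 hΛ.le) (Set.right_mem_Icc.2 hΛ.le) hΛ.le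
  simp only [dslope_same, hslope Λ hΛ.ne', mul_zero, sub_zero] at h
  rw [sub_le_iff_le_add, div_le_iff₀ hΛ] at h
  linarith

variable {α : Type*} [MeasurableSpace α] {μ : Measure α} [IsProbabilityMeasure μ] {F : α → ℝ}

theorem entropy_exp_mul {t : ℝ} (ht : t ∈ interior (integrableExpSet F μ)) :
    entropy μ (fun x => Real.exp (t * F x)) =
      mgf F μ t * (t * deriv (cgf F μ) t - cgf F μ t) := by
  have hpos : 0 < mgf F μ t := mgf_pos (interior_subset (s := integrableExpSet F μ) ht)
  have hlog : ∫ x, Real.exp (t * F x) * Real.log (Real.exp (t * F x)) ∂μ =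
      t * ∫ x, F x * Real.exp (t * F x) ∂μ := by
    rw [← integral_const_mul]
    congr with x
    rw [Real.log_exp]
    ring
  rw [deriv_cgf ht, entropy, hlog, ← mgf, ← cgf]
  field_simp

theorem cgf_le_of_entropy_le {D Λ : ℝ} (hΛ : 0 < Λ)
    (hF : ∀ t ∈ Set.Icc 0 Λ, t ∈ interior (integrableExpSet F μ))
    (hent : ∀ t ∈ Set.Ioc 0 Λ,
      entropy μ (fun x => Real.exp (t * F x)) ≤ t ^ 2 * D * mgf F μ t) :
    cgf F μ Λ ≤ Λ * ∫ x, F x ∂μ + Λ ^ 2 * D := by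
  have h := le_of_mul_deriv_sub_le (fun t ht => (analyticAt_cgf (hF t ht)).differentiableAt)
    cgf_zero hΛ (D := D) fun t ht => by
      have ht' := hF t ⟨ht.1.le, ht.2⟩
      have h := hent t ht
      rw [entropy_exp_mul ht', mul_comm (t ^ 2 * D)] at h
      exact le_of_mul_le_mul_left h (mgf_pos (interior_subset (s := integrableExpSet F μ) ht'))
  simpa [deriv_cgf_zero (hF 0 (Set.left_mem_Icc.2 hΛ.le))] using h

theorem measureReal_integral_add_le_of_entropy_le {D u : ℝ} (hD : 0 < D) (hu : 0 < u)
    (hF : ∀ t ∈ Set.Icc 0 √(u / D), t ∈ interior (integrableExpSet F μ))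
    (hent : ∀ t ∈ Set.Ioc 0 √(u / D),
      entropy μ (fun x => Real.exp (t * F x)) ≤ t ^ 2 * D * mgf F μ t) :
    μ.real {x | ∫ x, F x ∂μ + 2 * √(u * D) ≤ F x} ≤ Real.exp (-u) := by
  have hΛ : 0 < √(u / D) := Real.sqrt_pos.2 (by positivity)
  have hcgf := cgf_le_of_entropy_le hΛ hF hent
  refine (measure_ge_le_exp_cgf _ hΛ.le
    (interior_subset (s := integrableExpSet F μ) (hF _ (Set.right_mem_Icc.2 hΛ.le)))).trans
    (Real.exp_le_exp.2 ?_)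
  have hsq : √(u / D) ^ 2 * D = u := by rw [Real.sq_sqrt (by positivity)]; field_simp
  have hmul : √(u / D) * √(u * D) = u := by
    rw [← Real.sqrt_mul (by positivity), show u / D * (u * D) = u ^ 2 by field_simp,
      Real.sqrt_sq hu.le]
  linarith

end Herbst

section PoissonDeviation

variable {ι : Type*} [Fintype ι] [DecidableEq ι] (θ : ι → ℝ≥0) {F : (ι → ℕ) → ℝ}
  {a c b D : ℝ}

theorem entropy_exp_poissonPi_le {t : ℝ} (ht : 0 ≤ t) (hF : ∀ y, F y ∈ Set.Icc a c)
    (hb : ∀ y i, t * (F (y + Pi.single i 1) - F y) ≤ 1)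
    (hD : ∀ y, ∑ i, θ i * (F (y + Pi.single i 1) - F y) ^ 2 ≤ D) :
    entropy (poissonPi θ) (fun y => Real.exp (t * F y)) ≤ t ^ 2 * D * mgf F (poissonPi θ) t := by
  have hI : ∀ y, Real.exp (t * F y) ∈ Set.Icc (Real.exp (t * a)) (Real.exp (t * c)) := fun y =>
    ⟨Real.exp_le_exp.2 (mul_le_mul_of_nonneg_left (hF y).1 ht),
      Real.exp_le_exp.2 (mul_le_mul_of_nonneg_left (hF y).2 ht)⟩
  let B : ι → (ι → ℕ) → ℝ := fun i y =>
    bregman (Real.exp (t * F (y + Pi.single i 1))) (Real.exp (t * F y))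
  have hB : ∀ i, Integrable (fun y => θ i * B i y) (poissonPi θ) := fun i =>
    (integrable_bregman _ (Real.exp_pos _) (fun _ => hI _) hI).const_mul _
  have hBle : ∀ y i, B i y ≤
      t ^ 2 * Real.exp (t * F y) * (F (y + Pi.single i 1) - F y) ^ 2 := fun y i => by
    refine (bregman_exp_le ((mul_sub _ _ _).symm.trans_le (hb y i))).trans_eq ?_
    ring
  have hsum : ∀ y, ∑ i, θ i * B i y ≤ t ^ 2 * D * Real.exp (t * F y) := fun y =>
    calc ∑ i, θ i * B i y
        ≤ ∑ i, θ i * (t ^ 2 * Real.exp (t * F y) * (F (y + Pi.single i 1) - F y) ^ 2) :=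
          Finset.sum_le_sum fun i _ => mul_le_mul_of_nonneg_left (hBle y i) (θ i).coe_nonneg
      _ = t ^ 2 * Real.exp (t * F y) * ∑ i, θ i * (F (y + Pi.single i 1) - F y) ^ 2 := by
          rw [Finset.mul_sum]
          exact Finset.sum_congr rfl fun _ _ => by ring
      _ ≤ t ^ 2 * Real.exp (t * F y) * D := mul_le_mul_of_nonneg_left (hD y) (by positivity)
      _ = t ^ 2 * D * Real.exp (t * F y) := by ring
  calc entropy (poissonPi θ) (fun y => Real.exp (t * F y))
      ≤ ∑ i, θ i * ∫ y, B i y ∂(poissonPi θ) := by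
        simpa using hasModLogSobolev_poissonPi θ (Real.exp_pos _) _ hI
    _ = ∫ y, ∑ i, θ i * B i y ∂(poissonPi θ) := by
        simp only [integral_finsetSum _ fun i _ => hB i, integral_const_mul]
    _ ≤ ∫ y, t ^ 2 * D * Real.exp (t * F y) ∂(poissonPi θ) :=
        integral_mono (integrable_finsetSum _ fun i _ => hB i)
          ((integrable_of_mem_Icc _ hI).const_mul _) hsum
    _ = t ^ 2 * D * mgf F (poissonPi θ) t := integral_const_mul _ _

theorem measureReal_poissonPi_integral_add_le {u : ℝ} (hF : ∀ y, F y ∈ Set.Icc a c)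
    (hb : ∀ y i, F (y + Pi.single i 1) - F y ≤ b)
    (hD : ∀ y, ∑ i, θ i * (F (y + Pi.single i 1) - F y) ^ 2 ≤ D) (hb0 : 0 ≤ b) (hD0 : 0 < D)
    (hu : 0 < u) (hbD : b ^ 2 * u ≤ D) :
    (poissonPi θ).real {y | ∫ y, F y ∂(poissonPi θ) + 2 * √(u * D) ≤ F y} ≤ Real.exp (-u) := by
  have hexp : integrableExpSet F (poissonPi θ) = Set.univ := Set.eq_univ_of_forall fun _ =>
    integrable_exp_mul_of_mem_Icc Measurable.of_discrete.aemeasurable (.of_forall hF)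
  have hΛb : √(u / D) * b ≤ 1 := by
    rw [← abs_of_nonneg (mul_nonneg (Real.sqrt_nonneg (u / D)) hb0), ← sq_le_one_iff_abs_le_one,
      mul_pow, Real.sq_sqrt (by positivity), div_mul_eq_mul_div, div_le_one hD0, mul_comm]
    exact hbD
  refine measureReal_integral_add_le_of_entropy_le hD0 hu (by simp [hexp]) fun t ht =>
    entropy_exp_poissonPi_le θ ht.1.le hF (fun y i => ?_) hD
  calc t * (F (y + Pi.single i 1) - F y) ≤ t * b := mul_le_mul_of_nonneg_left (hb y i) ht.1.le
    _ ≤ √(u / D) * b := mul_le_mul_of_nonneg_right ht.2 hb0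
    _ ≤ 1 := hΛb

end PoissonDeviation

section Score

variable {ι E : Type*} [Fintype ι] [NormedAddCommGroup E] [InnerProductSpace ℝ E]

/-- The score `∑ᵢ (yᵢ - θᵢ) aᵢ` of a vector of counts `y` with rates `θᵢ` and features `aᵢ`. -/
noncomputable def poissonScore (θ : ι → ℝ≥0) (a : ι → E) (y : ι → ℕ) : E :=
  ∑ i, ((y i : ℝ) - θ i) • a i

theorem norm_poissonScore_sq (θ : ι → ℝ≥0) (a : ι → E) (y : ι → ℕ) :
    ‖poissonScore θ a y‖ ^ 2 = ∑ i, ((y i : ℝ) - θ i) * inner ℝ (poissonScore θ a y) (a i) := by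
  rw [← real_inner_self_eq_norm_sq]
  nth_rw 2 [poissonScore]
  simp only [inner_sum, real_inner_smul_right]

theorem sq_max_norm_add_sub_mul_le (s v : E) {T : ℝ} (hT : 0 ≤ T) :
    (max ‖s + v‖ T - max ‖s‖ T) ^ 2 * max ‖s‖ T ^ 2 ≤
      8 * inner ℝ s v ^ 2 + 2 * (‖v‖ ^ 2) ^ 2 := by
  have hmax : ∀ {x : ℝ}, 0 ≤ x → max x T ^ 2 = max (x ^ 2) (T ^ 2) := fun hx => by
    rcases le_total _ T with h | h
    · rw [max_eq_right h, max_eq_right (pow_le_pow_left₀ hx h 2)]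
    · rw [max_eq_left h, max_eq_left (pow_le_pow_left₀ hT h 2)]
  have hs : 0 ≤ max ‖s‖ T := hT.trans (le_max_right _ _)
  have hsv : 0 ≤ max ‖s + v‖ T := hT.trans (le_max_right _ _)
  have hfactor : |max ‖s + v‖ T - max ‖s‖ T| * max ‖s‖ T ≤ |2 * inner ℝ s v + ‖v‖ ^ 2| :=
    calc |max ‖s + v‖ T - max ‖s‖ T| * max ‖s‖ T
        ≤ |max ‖s + v‖ T - max ‖s‖ T| * |max ‖s + v‖ T + max ‖s‖ T| := by
          rw [abs_of_nonneg (add_nonneg hsv hs)]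
          exact mul_le_mul_of_nonneg_left (le_add_of_nonneg_left hsv) (abs_nonneg _)
      _ = |max (‖s + v‖ ^ 2) (T ^ 2) - max (‖s‖ ^ 2) (T ^ 2)| := by
          rw [← abs_mul, ← hmax (norm_nonneg _), ← hmax (norm_nonneg _), sq_sub_sq, mul_comm]
      _ ≤ |‖s + v‖ ^ 2 - ‖s‖ ^ 2| := abs_max_sub_max_le_abs _ _ _
      _ = |2 * inner ℝ s v + ‖v‖ ^ 2| := by rw [norm_add_sq_real]; ring_nf
  calc (max ‖s + v‖ T - max ‖s‖ T) ^ 2 * max ‖s‖ T ^ 2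
      = (|max ‖s + v‖ T - max ‖s‖ T| * max ‖s‖ T) ^ 2 := by rw [mul_pow, sq_abs]
    _ ≤ |2 * inner ℝ s v + ‖v‖ ^ 2| ^ 2 :=
        pow_le_pow_left₀ (mul_nonneg (abs_nonneg _) hs) hfactor 2
    _ ≤ 8 * inner ℝ s v ^ 2 + 2 * (‖v‖ ^ 2) ^ 2 := by
        rw [sq_abs]
        nlinarith [sq_nonneg (2 * inner ℝ s v - ‖v‖ ^ 2)]

theorem sum_mul_sq_max_norm_add_sub_le (θ : ι → ℝ≥0) (a : ι → E) (s : E) {M c b u T : ℝ}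
    (hM0 : 0 ≤ M) (hM : ∀ i, θ i ≤ M) (hc : ∑ i, inner ℝ s (a i) ^ 2 ≤ c ^ 2 * ‖s‖ ^ 2)
    (hb : ∀ i, ‖a i‖ ≤ b) (hu : 0 ≤ u) (hT : 0 ≤ T)
    (hTu : ∑ i, θ i * ‖a i‖ ^ 2 ≤ 8 * u * T ^ 2) :
    ∑ i, θ i * (max ‖s + a i‖ T - max ‖s‖ T) ^ 2 ≤ 8 * M * c ^ 2 + 16 * b ^ 2 * u := by
  have hsN : ‖s‖ ≤ max ‖s‖ T := le_max_left _ _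
  have hTN : T ≤ max ‖s‖ T := le_max_right _ _
  rcases (hT.trans hTN).eq_or_lt with hN | hN
  · obtain rfl : T = 0 := le_antisymm (hN ▸ hTN) hT
    obtain rfl : s = 0 := norm_le_zero_iff.1 (hN ▸ hsN)
    have hD : 0 ≤ 8 * M * c ^ 2 + 16 * b ^ 2 * u := by positivity
    simpa using hTu.trans (by simpa using hD)
  refine le_of_mul_le_mul_right ?_ (pow_pos hN 2)
  have hterm : ∀ i, θ i * (max ‖s + a i‖ T - max ‖s‖ T) ^ 2 * max ‖s‖ T ^ 2 ≤
      8 * M * inner ℝ s (a i) ^ 2 + 2 * b ^ 2 * (θ i * ‖a i‖ ^ 2) := fun i =>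
    calc θ i * (max ‖s + a i‖ T - max ‖s‖ T) ^ 2 * max ‖s‖ T ^ 2
        ≤ θ i * (8 * inner ℝ s (a i) ^ 2 + 2 * (‖a i‖ ^ 2) ^ 2) := by
          rw [mul_assoc]
          exact mul_le_mul_of_nonneg_left (sq_max_norm_add_sub_mul_le s (a i) hT)
            (θ i).coe_nonneg
      _ = 8 * (θ i * inner ℝ s (a i) ^ 2) + 2 * (θ i * ‖a i‖ ^ 2) * ‖a i‖ ^ 2 := by ring
      _ ≤ 8 * (M * inner ℝ s (a i) ^ 2) + 2 * (θ i * ‖a i‖ ^ 2) * b ^ 2 := by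
          gcongr
          exacts [hM i, hb i]
      _ = _ := by ring
  calc (∑ i, θ i * (max ‖s + a i‖ T - max ‖s‖ T) ^ 2) * max ‖s‖ T ^ 2
      ≤ 8 * M * ∑ i, inner ℝ s (a i) ^ 2 + 2 * b ^ 2 * ∑ i, θ i * ‖a i‖ ^ 2 := by
        rw [Finset.sum_mul, Finset.mul_sum, Finset.mul_sum, ← Finset.sum_add_distrib]
        exact Finset.sum_le_sum fun i _ => hterm i
    _ ≤ 8 * M * (c ^ 2 * max ‖s‖ T ^ 2) + 2 * b ^ 2 * (8 * u * max ‖s‖ T ^ 2) := by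
        have hs2 : c ^ 2 * ‖s‖ ^ 2 ≤ c ^ 2 * max ‖s‖ T ^ 2 := by gcongr
        have hT2 : 8 * u * T ^ 2 ≤ 8 * u * max ‖s‖ T ^ 2 := by gcongr
        exact add_le_add (mul_le_mul_of_nonneg_left (hc.trans hs2) (by positivity))
          (mul_le_mul_of_nonneg_left (hTu.trans hT2) (by positivity))
    _ = (8 * M * c ^ 2 + 16 * b ^ 2 * u) * max ‖s‖ T ^ 2 := by ring

variable (θ : ι → ℝ≥0) (a : ι → E)

theorem poissonScore_add_single [DecidableEq ι] (y : ι → ℕ) (i : ι) :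
    poissonScore θ a (y + Pi.single i 1) = poissonScore θ a y + a i := by
  have hterm : ∀ l, (((y + Pi.single i 1 : ι → ℕ) l : ℝ) - θ l) • a l =
      ((y l : ℝ) - θ l) • a l + if l = i then a l else 0 := fun l => by
    rcases eq_or_ne l i with rfl | h
    · simp [add_sub_right_comm, add_smul]
    · simp [h]
  simp only [poissonScore, hterm, Finset.sum_add_distrib, Finset.sum_ite_eq', Finset.mem_univ,
    if_true]

theorem inner_poissonScore_add_single [DecidableEq ι] (y : ι → ℕ) (i : ι) :
    inner ℝ (poissonScore θ a (y + Pi.single i 1)) (a i) =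
      inner ℝ (poissonScore θ a y) (a i) + ‖a i‖ ^ 2 := by
  rw [poissonScore_add_single, inner_add_left, real_inner_self_eq_norm_sq]

theorem integrable_inner_poissonScore (v : E) :
    Integrable (fun y => inner ℝ (poissonScore θ a y) v) (poissonPi θ) := by
  simp only [poissonScore, sum_inner, real_inner_smul_left]
  exact integrable_finsetSum _ fun i _ =>
    ((integrable_eval_poissonPi θ i).sub (integrable_const _)).mul_const _

theorem integrable_eval_mul_inner_poissonScore (i : ι) :
    Integrable (fun y => (y i : ℝ) * inner ℝ (poissonScore θ a y) (a i)) (poissonPi θ) := by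
  classical
  refine integrable_eval_mul_poissonPi θ i ?_
  simp only [inner_poissonScore_add_single]
  exact (integrable_inner_poissonScore θ a _).add (integrable_const _)

theorem integrable_sub_mul_inner_poissonScore (i : ι) :
    Integrable (fun y => ((y i : ℝ) - θ i) * inner ℝ (poissonScore θ a y) (a i))
      (poissonPi θ) := by
  simp only [sub_mul]
  exact (integrable_eval_mul_inner_poissonScore θ a i).sub
    ((integrable_inner_poissonScore θ a _).const_mul _)

theorem integral_sub_mul_inner_poissonScore (i : ι) :
    ∫ y, ((y i : ℝ) - θ i) * inner ℝ (poissonScore θ a y) (a i) ∂(poissonPi θ) =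
      θ i * ‖a i‖ ^ 2 := by
  classical
  have hint := integrable_inner_poissonScore θ a (a i)
  simp only [sub_mul]
  rw [integral_sub (integrable_eval_mul_inner_poissonScore θ a i) (hint.const_mul _),
    integral_const_mul, integral_eval_mul_poissonPi θ fun y => inner ℝ (poissonScore θ a y) (a i)]
  simp only [inner_poissonScore_add_single]
  rw [integral_add hint (integrable_const _), integral_const, probReal_univ, one_smul]
  ring

theorem memLp_two_norm_poissonScore :
    MemLp (fun y => ‖poissonScore θ a y‖) 2 (poissonPi θ) := by
  rw [memLp_two_iff_integrable_sq .of_discrete]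
  simp only [norm_poissonScore_sq]
  exact integrable_finsetSum _ fun i _ => integrable_sub_mul_inner_poissonScore θ a i

theorem integral_norm_poissonScore_sq :
    ∫ y, ‖poissonScore θ a y‖ ^ 2 ∂(poissonPi θ) = ∑ i, θ i * ‖a i‖ ^ 2 := by
  simp only [norm_poissonScore_sq]
  rw [integral_finsetSum _ fun i _ => integrable_sub_mul_inner_poissonScore θ a i]
  simp only [integral_sub_mul_inner_poissonScore]

theorem integral_norm_poissonScore_le :
    ∫ y, ‖poissonScore θ a y‖ ∂(poissonPi θ) ≤ √(∑ i, θ i * ‖a i‖ ^ 2) := by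
  have hvar := variance_nonneg (fun y => ‖poissonScore θ a y‖) (poissonPi θ)
  rw [variance_eq_sub (memLp_two_norm_poissonScore θ a)] at hvar
  refine Real.le_sqrt_of_sq_le ?_
  rw [← integral_norm_poissonScore_sq]
  exact sub_nonneg.1 hvar

theorem integral_min_max_norm_poissonScore_le {T R : ℝ} (hT : 0 ≤ T) (hR : 0 ≤ R) :
    ∫ y, min (max ‖poissonScore θ a y‖ T) R ∂(poissonPi θ) ≤ √(∑ i, θ i * ‖a i‖ ^ 2) + T := by
  have hnorm : Integrable (fun y => ‖poissonScore θ a y‖) (poissonPi θ) :=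
    (memLp_two_norm_poissonScore θ a).integrable one_le_two
  have hF : Integrable (fun y => min (max ‖poissonScore θ a y‖ T) R) (poissonPi θ) :=
    integrable_of_mem_Icc _ fun _ =>
      ⟨le_min (hT.trans (le_max_right _ _)) hR, min_le_right _ _⟩
  calc ∫ y, min (max ‖poissonScore θ a y‖ T) R ∂(poissonPi θ)
      ≤ ∫ y, (‖poissonScore θ a y‖ + T) ∂(poissonPi θ) :=
        integral_mono hF (hnorm.add (integrable_const T)) fun _ =>
          (min_le_left _ _).trans (max_le_add_of_nonneg (norm_nonneg _) hT)
    _ ≤ √(∑ i, θ i * ‖a i‖ ^ 2) + T := by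
        rw [integral_add hnorm (integrable_const T), integral_const, probReal_univ, one_smul]
        exact add_le_add_left (integral_norm_poissonScore_le θ a) T

-- Herbst's argument is applied to `min (max ‖S‖ T) R`: truncating at `R` makes it bounded, and
-- truncating at `T` keeps the division by the norm in the gradient bound under control.
theorem measureReal_norm_poissonScore_ge_le {M c b u T : ℝ} (hM0 : 0 ≤ M) (hM : ∀ i, θ i ≤ M)
    (hc : ∀ y, ∑ i, inner ℝ (poissonScore θ a y) (a i) ^ 2 ≤ c ^ 2 * ‖poissonScore θ a y‖ ^ 2)
    (hb0 : 0 < b) (hb : ∀ i, ‖a i‖ ≤ b) (hu : 0 < u) (hT : 0 ≤ T)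
    (hTu : ∑ i, θ i * ‖a i‖ ^ 2 ≤ 8 * u * T ^ 2) :
    (poissonPi θ).real {y | √(∑ i, θ i * ‖a i‖ ^ 2) + T +
      2 * √(u * (8 * M * c ^ 2 + 16 * b ^ 2 * u)) ≤ ‖poissonScore θ a y‖} ≤ Real.exp (-u) := by
  classical
  set S := poissonScore θ a
  set D := 8 * M * c ^ 2 + 16 * b ^ 2 * u with hD
  set R := √(∑ i, θ i * ‖a i‖ ^ 2) + T + 2 * √(u * D)
  let F : (ι → ℕ) → ℝ := fun y => min (max ‖S y‖ T) R
  have hR : 0 ≤ R := by positivity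
  have hF : ∀ y, F y ∈ Set.Icc 0 R := fun y =>
    ⟨le_min (hT.trans (le_max_right _ _)) hR, min_le_right _ _⟩
  have hjump : ∀ y i, |F (y + Pi.single i 1) - F y| ≤ |max ‖S y + a i‖ T - max ‖S y‖ T| :=
    fun y i => by
      simp only [F, S, poissonScore_add_single]
      exact abs_inf_sub_inf_le_abs _ _ _
  have hjump_le : ∀ y i, F (y + Pi.single i 1) - F y ≤ b := fun y i =>
    calc F (y + Pi.single i 1) - F y ≤ |max ‖S y + a i‖ T - max ‖S y‖ T| :=
          (le_abs_self _).trans (hjump y i)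
      _ ≤ |‖S y + a i‖ - ‖S y‖| := abs_max_sub_max_le_abs _ _ _
      _ ≤ ‖a i‖ := by simpa using abs_norm_sub_norm_le (S y + a i) (S y)
      _ ≤ b := hb i
  have hgrad : ∀ y, ∑ i, θ i * (F (y + Pi.single i 1) - F y) ^ 2 ≤ D := fun y =>
    (Finset.sum_le_sum fun i _ => mul_le_mul_of_nonneg_left (sq_le_sq.2 (hjump y i))
      (θ i).coe_nonneg).trans (sum_mul_sq_max_norm_add_sub_le θ a (S y) hM0 hM (hc y) hb
        hu.le hT hTu)
  have hbD : b ^ 2 * u ≤ D := by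
    have hMc : 0 ≤ 8 * M * c ^ 2 := by positivity
    have hbu : 0 ≤ b ^ 2 * u := by positivity
    linarith [hD]
  refine (measureReal_mono fun y (hy : R ≤ ‖S y‖) => ?_).trans
    (measureReal_poissonPi_integral_add_le θ hF hjump_le hgrad hb0.le (by positivity) hu hbD)
  calc ∫ y, F y ∂(poissonPi θ) + 2 * √(u * D) ≤ R :=
        add_le_add_left (integral_min_max_norm_poissonScore_le θ a hT hR) _
    _ = F y := (min_eq_right (hy.trans (le_max_left _ _))).symm

end Score

section LowerTail

theorem exp_neg_le_one_sub_add_sq_div_two {x : ℝ} (hx : 0 ≤ x) :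
    Real.exp (-x) ≤ 1 - x + x ^ 2 / 2 := by
  have hpos : 0 < 1 - x + x ^ 2 / 2 := by nlinarith [sq_nonneg (x - 1)]
  have hquad := Real.quadratic_le_exp_of_nonneg hx
  rw [Real.exp_neg, inv_le_iff_one_le_mul₀ (Real.exp_pos x)]
  calc (1 : ℝ) ≤ (1 - x + x ^ 2 / 2) * (1 + x + x ^ 2 / 2) := by nlinarith [sq_nonneg (x ^ 2)]
    _ ≤ (1 - x + x ^ 2 / 2) * Real.exp x := mul_le_mul_of_nonneg_left hquad hpos.le

theorem le_add_sqrt_add_of_sub_sqrt_le {V v q : ℝ} (hV : 0 ≤ V) (hv : 0 ≤ v) (hq : 0 ≤ q)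
    (h : V - √(2 * q * V) ≤ v) : V ≤ v + √(2 * q * v) + 2 * q := by
  have hs : ∀ x, √(2 * q * x) = √(2 * q) * √x := fun x => Real.sqrt_mul (by positivity) x
  have hx := Real.sqrt_nonneg V
  have hy := Real.sqrt_nonneg v
  have ht := Real.sqrt_nonneg (2 * q)
  have hx2 := Real.sq_sqrt hV
  have hy2 := Real.sq_sqrt hv
  have ht2 := Real.sq_sqrt (by positivity : 0 ≤ 2 * q)
  rw [hs] at h ⊢
  have hxy : √V ≤ √v + √(2 * q) := by
    by_contra! hlt
    nlinarith [mul_nonneg hx (sub_nonneg.2 hlt.le), mul_nonneg hy (sub_nonneg.2 hlt.le)]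
  calc V ≤ v + √(2 * q) * √V := by linarith
    _ ≤ v + √(2 * q) * (√v + √(2 * q)) := by gcongr
    _ = v + √(2 * q) * √v + 2 * q := by rw [mul_add, ← sq, ht2, add_assoc]

theorem measureReal_le_sub_sqrt_le_of_mgf_le {Ω : Type*} [MeasurableSpace Ω] {μ : Measure Ω}
    [IsFiniteMeasure μ] {f : Ω → ℝ} {a s u : ℝ} (hs : 0 < s) (hu : 0 ≤ u)
    (hint : ∀ t, 0 ≤ t → Integrable (fun x => Real.exp (-t * f x)) μ)
    (hmgf : ∀ t, 0 ≤ t → mgf f μ (-t) ≤ Real.exp (-t * a + t ^ 2 * s / 2)) :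
    μ.real {x | f x ≤ a - √(2 * u * s)} ≤ Real.exp (-u) := by
  set t := √(2 * u / s) with ht
  have ht0 : 0 ≤ t := Real.sqrt_nonneg _
  have hsq : t ^ 2 * s / 2 = u := by
    rw [ht, Real.sq_sqrt (by positivity)]
    field_simp
  have hcross : t * √(2 * u * s) = 2 * u := by
    rw [ht, ← Real.sqrt_mul (by positivity),
      show 2 * u / s * (2 * u * s) = (2 * u) ^ 2 by field_simp, Real.sqrt_sq (by positivity)]
  calc μ.real {x | f x ≤ a - √(2 * u * s)}
      ≤ Real.exp (- -t * (a - √(2 * u * s))) * mgf f μ (-t) :=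
        measure_le_le_exp_mul_mgf _ (neg_nonpos.2 ht0) (hint t ht0)
    _ ≤ Real.exp (- -t * (a - √(2 * u * s))) * Real.exp (-t * a + t ^ 2 * s / 2) :=
        mul_le_mul_of_nonneg_left (hmgf t ht0) (Real.exp_pos _).le
    _ = Real.exp (-u) := by
        rw [← Real.exp_add, neg_neg, mul_sub, hcross, hsq]
        ring_nf

theorem mgf_poissonMeasure (r : ℝ≥0) (t : ℝ) :
    mgf (fun k : ℕ => (k : ℝ)) (poissonMeasure r) t = Real.exp (r * (Real.exp t - 1)) := by
  have h := (NormedSpace.expSeries_div_hasSum_exp (𝔸 := ℝ) (r * Real.exp t)).mul_left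
    (Real.exp (-r))
  rw [← Real.exp_eq_exp_ℝ, ← Real.exp_add] at h
  rw [mgf, integral_poissonMeasure, mul_sub, mul_one, sub_eq_neg_add, ← h.tsum_eq]
  congr with k
  rw [mul_comm t, Real.exp_nat_mul, mul_pow, smul_eq_mul]
  ring

variable {ι : Type*} [Fintype ι] (θ : ι → ℝ≥0)

theorem mgf_sum_mul_poissonPi (w : ι → ℝ) (t : ℝ) :
    mgf (fun y => ∑ i, w i * (y i : ℝ)) (poissonPi θ) t =
      Real.exp (∑ i, θ i * (Real.exp (t * w i) - 1)) := by
  simp only [Real.exp_sum, ← mgf_poissonMeasure, mgf]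
  rw [← integral_fintype_prod_eq_prod fun i (k : ℕ) => Real.exp (t * w i * k)]
  simp only [← Real.exp_sum, Finset.mul_sum, mul_assoc]

variable {w : ι → ℝ} {m : ℝ}

theorem mgf_neg_sum_mul_poissonPi_le (hw0 : ∀ i, 0 ≤ w i) (hwm : ∀ i, w i ≤ m) {t : ℝ}
    (ht : 0 ≤ t) :
    mgf (fun y => ∑ i, w i * (y i : ℝ)) (poissonPi θ) (-t) ≤
      Real.exp (-t * ∑ i, w i * θ i + t ^ 2 * m / 2 * ∑ i, w i * θ i) := by
  rw [mgf_sum_mul_poissonPi, Real.exp_le_exp, ← add_mul, Finset.mul_sum]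
  refine Finset.sum_le_sum fun i _ => ?_
  have hexp : Real.exp (-t * w i) - 1 ≤ (-t + t ^ 2 * m / 2) * w i :=
    calc Real.exp (-t * w i) - 1 ≤ -t * w i + t ^ 2 * w i * w i / 2 := by
          rw [neg_mul]
          linarith [exp_neg_le_one_sub_add_sq_div_two (mul_nonneg ht (hw0 i))]
      _ ≤ -t * w i + t ^ 2 * w i * m / 2 := by
          have := mul_le_mul_of_nonneg_left (hwm i) (mul_nonneg (sq_nonneg t) (hw0 i))
          linarith
      _ = (-t + t ^ 2 * m / 2) * w i := by ring
  linarith [mul_le_mul_of_nonneg_left hexp (θ i).coe_nonneg]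

theorem measureReal_sum_mul_poissonPi_lt_le (hw0 : ∀ i, 0 ≤ w i) (hwm : ∀ i, w i ≤ m) {u : ℝ}
    (hu : 0 ≤ u) :
    (poissonPi θ).real {y | ∑ i, w i * (y i : ℝ) <
      ∑ i, w i * θ i - √(2 * u * (m * ∑ i, w i * θ i))} ≤ Real.exp (-u) := by
  have hL : ∀ y : ι → ℕ, 0 ≤ ∑ i, w i * (y i : ℝ) := fun y =>
    Finset.sum_nonneg fun i _ => mul_nonneg (hw0 i) (Nat.cast_nonneg _)
  have hV : 0 ≤ ∑ i, w i * (θ i : ℝ) :=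
    Finset.sum_nonneg fun i _ => mul_nonneg (hw0 i) (θ i).coe_nonneg
  rcases hV.eq_or_lt with hV0 | hVpos
  · simp [← hV0, (hL _).not_gt, (Real.exp_pos _).le]
  have hVm : ∑ i, w i * (θ i : ℝ) ≤ m * ∑ i, (θ i : ℝ) := by
    rw [Finset.mul_sum]
    exact Finset.sum_le_sum fun i _ => mul_le_mul_of_nonneg_right (hwm i) (θ i).coe_nonneg
  have hm : 0 < m := pos_of_mul_pos_left (hVpos.trans_le hVm) (by positivity)
  have hint : ∀ t, 0 ≤ t →
      Integrable (fun y => Real.exp (-t * ∑ i, w i * (y i : ℝ))) (poissonPi θ) := fun t ht =>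
    integrable_of_mem_Icc _ (m := 0) (C := 1) fun y => ⟨(Real.exp_pos _).le,
      Real.exp_le_one_iff.2 (mul_nonpos_of_nonpos_of_nonneg (neg_nonpos.2 ht) (hL y))⟩
  calc (poissonPi θ).real {y | ∑ i, w i * (y i : ℝ) <
        ∑ i, w i * θ i - √(2 * u * (m * ∑ i, w i * θ i))}
      ≤ (poissonPi θ).real {y | ∑ i, w i * (y i : ℝ) ≤
          ∑ i, w i * θ i - √(2 * u * (m * ∑ i, w i * θ i))} :=
        measureReal_mono (Set.ofPred_subset_ofPred.2 fun _ => le_of_lt)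
    _ ≤ Real.exp (-u) :=
        measureReal_le_sub_sqrt_le_of_mgf_le (mul_pos hm hVpos) hu hint fun t ht =>
          (mgf_neg_sum_mul_poissonPi_le θ hw0 hwm ht).trans_eq (by ring_nf)

end LowerTail

section GroupWeight

variable {n p : ℕ} (A : Matrix (Fin n) (Fin p) ℝ) (G : Finset (Fin p)) (θ : Fin n → ℝ≥0)

theorem varHat_nonneg (y : Fin n → ℕ) (j : Fin p) : 0 ≤ varHat A y j :=
  Finset.sum_nonneg fun _ _ => mul_nonneg (sq_nonneg _) (Nat.cast_nonneg _)

theorem measureReal_varTilde_lt_le {γ : ℝ} (hγ : 0 ≤ γ) (j : Fin p) :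
    (poissonPi θ).real {y | varTilde A G γ y j < ∑ i, A i j ^ 2 * θ i} ≤
      Real.exp (-(γ * Real.log p + Real.log G.card)) := by
  have hw : 0 ≤ γ * Real.log p + Real.log G.card :=
    add_nonneg (mul_nonneg hγ (Real.log_natCast_nonneg p)) (Real.log_natCast_nonneg _)
  have hm : 0 ≤ ⨆ i, A i j ^ 2 := Real.iSup_nonneg fun i => sq_nonneg _
  refine (measureReal_mono (Set.ofPred_subset_ofPred.2 fun y hy => ?_)).trans
    (measureReal_sum_mul_poissonPi_lt_le θ (fun i => sq_nonneg (A i j))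
      (fun i => le_ciSup (f := fun i => A i j ^ 2) (Set.finite_range _).bddAbove i) hw)
  rw [varTilde] at hy
  set w := γ * Real.log p + Real.log G.card
  set m := ⨆ i, A i j ^ 2
  set V := ∑ i, A i j ^ 2 * (θ i : ℝ)
  change varHat A y j < V - √(2 * w * (m * V))
  contrapose! hy
  rw [show 2 * w * (m * V) = 2 * (w * m) * V by ring] at hy
  have hV : 0 ≤ V := Finset.sum_nonneg fun i _ => mul_nonneg (sq_nonneg _) (θ i).coe_nonneg
  calc V ≤ varHat A y j + √(2 * (w * m) * varHat A y j) + 2 * (w * m) :=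
        le_add_sqrt_add_of_sub_sqrt_le hV (varHat_nonneg A y j) (mul_nonneg hw hm) hy
    _ ≤ varHat A y j + √(2 * (w * m) * varHat A y j) + 3 * (w * m) := by gcongr; norm_num
    _ = varHat A y j + √(2 * w * varHat A y j * m) + 3 * w * m := by ring_nf

theorem measureReal_exists_varTilde_lt_le {γ : ℝ} (hγ : 0 ≤ γ) :
    (poissonPi θ).real {y | ∃ j ∈ G, varTilde A G γ y j < ∑ i, A i j ^ 2 * θ i} ≤
      Real.exp (-(γ * Real.log p)) := by
  have hset : {y | ∃ j ∈ G, varTilde A G γ y j < ∑ i, A i j ^ 2 * θ i} =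
      ⋃ j ∈ G, {y | varTilde A G γ y j < ∑ i, A i j ^ 2 * θ i} := by
    ext
    simp
  calc (poissonPi θ).real {y | ∃ j ∈ G, varTilde A G γ y j < ∑ i, A i j ^ 2 * θ i}
      ≤ ∑ j ∈ G, (poissonPi θ).real {y | varTilde A G γ y j < ∑ i, A i j ^ 2 * θ i} :=
        hset ▸ measureReal_biUnion_finset_le _ _
    _ ≤ ∑ _j ∈ G, Real.exp (-(γ * Real.log p + Real.log G.card)) :=
        Finset.sum_le_sum fun j _ => measureReal_varTilde_lt_le A G θ hγ j
    _ ≤ Real.exp (-(γ * Real.log p)) := by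
        rw [Finset.sum_const, nsmul_eq_mul, neg_add, Real.exp_add, mul_left_comm]
        refine mul_le_of_le_one_right (Real.exp_pos _).le ?_
        rcases G.eq_empty_or_nonempty with rfl | hG
        · simp
        · have hcard : (0 : ℝ) < G.card := Nat.cast_pos.2 hG.card_pos
          rw [Real.exp_neg, Real.exp_log hcard, mul_inv_cancel₀ hcard.ne']

theorem le_groupWeight {M γ : ℝ} {y : Fin n → ℕ}
    (hy : ∀ j ∈ G, ∑ i, A i j ^ 2 * θ i ≤ varTilde A G γ y j) :
    (1 + 1 / (2 * √(2 * γ * Real.log p))) * √(∑ j ∈ G, ∑ i, A i j ^ 2 * θ i) +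
      2 * √(γ * Real.log p * dConst A G M γ) ≤ groupWeight A G M γ y := by
  rw [groupWeight]
  gcongr with j hj
  exact hy j hj

/-- The `i`-th row of `A_G` as a vector of Euclidean space, so that `A_Gᵀ (y - θ)` is the Poisson
score with these features. -/
def groupFeature (i : Fin n) : EuclideanSpace ℝ G := WithLp.toLp 2 (groupMatrix A G i)

theorem norm_groupFeature (i : Fin n) : ‖groupFeature A G i‖ = √(∑ j ∈ G, A i j ^ 2) := by
  rw [EuclideanSpace.norm_eq, ← Finset.sum_coe_sort G fun j => A i j ^ 2]
  simp [groupFeature, groupMatrix]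

theorem norm_groupFeature_le_bConst (i : Fin n) : ‖groupFeature A G i‖ ≤ bConst A G := by
  rw [norm_groupFeature]
  exact le_ciSup (f := fun i => √(∑ j ∈ G, A i j ^ 2)) (Set.finite_range _).bddAbove i

theorem sum_mul_norm_groupFeature_sq :
    ∑ i, θ i * ‖groupFeature A G i‖ ^ 2 = ∑ j ∈ G, ∑ i, A i j ^ 2 * (θ i : ℝ) := by
  rw [Finset.sum_comm]
  refine Finset.sum_congr rfl fun i _ => ?_
  rw [norm_groupFeature, Real.sq_sqrt (Finset.sum_nonneg fun _ _ => sq_nonneg _),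
    ← Finset.sum_mul, mul_comm]

theorem toLp_transpose_groupMatrix_mulVec_sub (y : Fin n → ℕ) :
    WithLp.toLp 2 ((groupMatrix A G)ᵀ *ᵥ fun i => (y i : ℝ) - θ i) =
      poissonScore θ (groupFeature A G) y := by
  ext j
  simp [poissonScore, groupFeature, Matrix.mulVec, dotProduct, mul_comm]

theorem inner_groupFeature (v : G → ℝ) (i : Fin n) :
    inner ℝ (WithLp.toLp 2 v) (groupFeature A G i) = (groupMatrix A G *ᵥ v) i := by
  simp [groupFeature, PiLp.inner_apply, Matrix.mulVec, dotProduct]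

theorem l2norm_groupMatrix_mulVec_le (v : Fin n → ℝ) :
    l2norm (groupMatrix A G *ᵥ ((groupMatrix A G)ᵀ *ᵥ v)) ≤
      cConst A G * l2norm ((groupMatrix A G)ᵀ *ᵥ v) := by
  set B := groupMatrix A G
  have hpos : ∀ w, Bᵀ *ᵥ w ≠ 0 → 0 < l2norm (Bᵀ *ᵥ w) := fun w hw => by
    rwa [l2norm, norm_pos_iff, ne_eq, WithLp.toLp_eq_zero]
  rcases eq_or_ne (Bᵀ *ᵥ v) 0 with hv | hv
  · simp [hv, l2norm]
  let L : EuclideanSpace ℝ G →L[ℝ] EuclideanSpace ℝ (Fin n) :=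
    LinearMap.toContinuousLinearMap (Matrix.toLpLin 2 2 B)
  rw [← div_le_iff₀ (hpos v hv), Matrix.mulVec_mulVec]
  refine le_csSup ⟨‖L‖, ?_⟩ ⟨v, hv, rfl⟩
  rintro _ ⟨w, hw, rfl⟩
  rw [div_le_iff₀ (hpos w hw), ← Matrix.mulVec_mulVec]
  exact L.le_opNorm (WithLp.toLp 2 (Bᵀ *ᵥ w))

theorem sum_inner_poissonScore_groupFeature_sq_le (y : Fin n → ℕ) :
    ∑ i, inner ℝ (poissonScore θ (groupFeature A G) y) (groupFeature A G i) ^ 2 ≤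
      cConst A G ^ 2 * ‖poissonScore θ (groupFeature A G) y‖ ^ 2 := by
  have hc := l2norm_groupMatrix_mulVec_le A G fun i => (y i : ℝ) - θ i
  simp only [← toLp_transpose_groupMatrix_mulVec_sub, inner_groupFeature]
  rw [← mul_pow, ← EuclideanSpace.real_norm_sq_eq (WithLp.toLp 2 _)]
  exact pow_le_pow_left₀ (norm_nonneg _) hc 2

variable {A G θ} {M γ : ℝ}

theorem bConst_pos (hA : groupMatrix A G ≠ 0) : 0 < bConst A G := by
  obtain ⟨i, hi⟩ := Function.ne_iff.1 hA
  refine (norm_pos_iff.2 fun h => hi ?_).trans_le (norm_groupFeature_le_bConst A G i)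
  exact (WithLp.toLp_eq_zero 2).1 h

theorem measureReal_l2norm_score_ge_le (hM0 : 0 ≤ M) (hM : ∀ i, θ i ≤ M)
    (hu : 0 < γ * Real.log p) (hA : groupMatrix A G ≠ 0) :
    (poissonPi θ).real {y | (1 + 1 / (2 * √(2 * γ * Real.log p))) *
          √(∑ j ∈ G, ∑ i, A i j ^ 2 * θ i) + 2 * √(γ * Real.log p * dConst A G M γ) ≤
        l2norm ((groupMatrix A G)ᵀ *ᵥ fun i => (y i : ℝ) - θ i)} ≤
      Real.exp (-(γ * Real.log p)) := by
  have hV : 0 ≤ ∑ j ∈ G, ∑ i, A i j ^ 2 * (θ i : ℝ) :=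
    Finset.sum_nonneg fun j _ => Finset.sum_nonneg fun i _ =>
      mul_nonneg (sq_nonneg _) (θ i).coe_nonneg
  simp only [l2norm, toLp_transpose_groupMatrix_mulVec_sub, dConst, mul_assoc _ γ]
  rw [← sum_mul_norm_groupFeature_sq] at hV ⊢
  set u := γ * Real.log p
  set V := ∑ i, θ i * ‖groupFeature A G i‖ ^ 2
  have hT : V ≤ 8 * u * (√V / (2 * √(2 * u))) ^ 2 := by
    rw [div_pow, mul_pow, Real.sq_sqrt hV, Real.sq_sqrt (by positivity)]
    field_simp
    norm_num
  convert measureReal_norm_poissonScore_ge_le θ (groupFeature A G) hM0 hM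
    (sum_inner_poissonScore_groupFeature_sq_le A G θ) (bConst_pos hA)
    (norm_groupFeature_le_bConst A G) hu (by positivity) hT using 5
  ring

theorem measureReal_groupWeight_le (hγ : 0 < γ) (hM : ∀ i, θ i ≤ M) (hA : groupMatrix A G ≠ 0) :
    (poissonPi θ).real {y | groupWeight A G M γ y ≤
      l2norm ((groupMatrix A G)ᵀ *ᵥ fun i => (y i : ℝ) - θ i)} ≤ 2 / (p : ℝ) ^ γ := by
  obtain ⟨i, hi⟩ := Function.ne_iff.1 hA
  obtain ⟨j, -⟩ := Function.ne_iff.1 hi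
  rcases (Nat.one_le_iff_ne_zero.2 (j : Fin p).pos.ne').eq_or_lt with rfl | hp
  · exact measureReal_le_one.trans (by norm_num)
  have hp0 : (0 : ℝ) < p := Nat.cast_pos.2 (zero_lt_one.trans hp)
  have hu : 0 < γ * Real.log p := mul_pos hγ (Real.log_pos (Nat.one_lt_cast.2 hp))
  let S : Set (Fin n → ℕ) := {y | (1 + 1 / (2 * √(2 * γ * Real.log p))) *
      √(∑ j ∈ G, ∑ i, A i j ^ 2 * θ i) + 2 * √(γ * Real.log p * dConst A G M γ) ≤
    l2norm ((groupMatrix A G)ᵀ *ᵥ fun i => (y i : ℝ) - θ i)}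
  let N : Set (Fin n → ℕ) := {y | ∃ j ∈ G, varTilde A G γ y j < ∑ i, A i j ^ 2 * θ i}
  calc (poissonPi θ).real {y | groupWeight A G M γ y ≤
        l2norm ((groupMatrix A G)ᵀ *ᵥ fun i => (y i : ℝ) - θ i)}
      ≤ (poissonPi θ).real (S ∪ N) := measureReal_mono fun y hy => by
        by_cases hN : y ∈ N
        · exact .inr hN
        · refine .inl ((le_groupWeight A G θ fun j hj => ?_).trans hy)
          exact not_lt.1 fun hlt => hN ⟨j, hj, hlt⟩
    _ ≤ (poissonPi θ).real S + (poissonPi θ).real N := measureReal_union_le _ _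
    _ ≤ Real.exp (-(γ * Real.log p)) + Real.exp (-(γ * Real.log p)) :=
        add_le_add
          (measureReal_l2norm_score_ge_le ((θ i).coe_nonneg.trans (hM i)) hM hu hA)
          (measureReal_exists_varTilde_lt_le A G θ hγ.le)
    _ = 2 / (p : ℝ) ^ γ := by
        rw [Real.rpow_def_of_pos hp0, ← two_mul, Real.exp_neg, mul_comm γ, div_eq_mul_inv]

end GroupWeight

theorem meanVec_poissonPi {n : ℕ} (θ : Fin n → ℝ≥0) : meanVec (poissonPi θ) = fun i => (θ i : ℝ) :=
  funext (integral_eval_poissonPi θ)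

end PoissonGroupLasso

open PoissonGroupLasso in
theorem theorem2_general {Ω : Type*} [MeasurableSpace Ω] (P : Measure Ω) [IsProbabilityMeasure P]
    {n d p : ℕ} (f₀ : (Fin d → ℝ) → ℝ) (φ : Fin p → (Fin d → ℝ) → ℝ)
    (X : Ω → Fin n → Fin d → ℝ) (Y : Ω → Fin n → ℕ)
    (hf₀ : ∀ t ∈ Set.Icc (0 : Fin d → ℝ) 1, 0 ≤ f₀ t) (hmodel : IsPoissonRegression P f₀ X Y)
    (G : Finset (Fin p)) (γ : ℝ) (hγ : 0 < γ)
    (M : ℝ) (hf₀M : ∀ t ∈ Set.Icc (0 : Fin d → ℝ) 1, f₀ t ≤ M) :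
    ∀ᵐ x ∂(P.map X), groupMatrix (designMatrix φ x) G ≠ 0 →
      (condDistrib Y X P x).real {y | groupWeight (designMatrix φ x) G M γ y ≤
          l2norm ((groupMatrix (designMatrix φ x) G)ᵀ *ᵥ
            fun i => (y i : ℝ) - meanVec (condDistrib Y X P x) i)} ≤ 2 / (p : ℝ) ^ γ := by
  have hcube : MeasurableSet {x : Fin n → Fin d → ℝ | ∀ i, x i ∈ Set.Icc (0 : Fin d → ℝ) 1} := by
    simpa only [Set.pi, Set.mem_univ, true_imp_iff] using
      MeasurableSet.univ_pi fun _ : Fin n => measurableSet_Icc (a := (0 : Fin d → ℝ)) (b := 1)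
  have hX : ∀ᵐ x ∂(P.map X), ∀ i, x i ∈ Set.Icc (0 : Fin d → ℝ) 1 :=
    (ae_map_iff hmodel.measurable_design.aemeasurable hcube).2 hmodel.mem_cube
  filter_upwards [hX, hmodel.condLaw] with x hx hlaw hA
  have hM : ∀ i, ((f₀ (x i)).toNNReal : ℝ) ≤ M := fun i =>
    (Real.coe_toNNReal _ (hf₀ _ (hx i))).trans_le (hf₀M _ (hx i))
  rw [hlaw, meanVec_poissonPi]
  exact measureReal_groupWeight_le hγ hM hA

/-- Expectations and probabilities are conditional on the design: they are taken under the
conditional law `condDistrib Y X P x` of the counts, at almost every design `x`. -/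
theorem theorem2 {Ω : Type*} [MeasurableSpace Ω] (P : Measure Ω) [IsProbabilityMeasure P]
    {n d p K : ℕ} (f₀ : (Fin d → ℝ) → ℝ) (φ : Fin p → (Fin d → ℝ) → ℝ)
    (X : Ω → Fin n → Fin d → ℝ) (Y : Ω → Fin n → ℕ)
    (hpos : ∀ t ∈ Set.Icc (0 : Fin d → ℝ) 1, 0 < f₀ t)
    (hmodel : PoissonGroupLasso.IsPoissonRegression P f₀ X Y)
    (G : Fin K → Finset (Fin p)) (hG_nonempty : ∀ k, (G k).Nonempty)
    (hG_disjoint : Pairwise fun k l => Disjoint (G k) (G l))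
    (hG_cover : ∀ j : Fin p, ∃ k, j ∈ G k)
    (k : Fin K) (γ : ℝ) (hγ : 0 < γ)
    (M : ℝ) (hM : 0 < M) (hf₀M : ∀ t ∈ Set.Icc (0 : Fin d → ℝ) 1, |f₀ t| ≤ M) :
    ∀ᵐ x ∂(P.map X),
      PoissonGroupLasso.groupMatrix (PoissonGroupLasso.designMatrix φ x) (G k) ≠ 0 →
      (condDistrib Y X P x).real
          {y | PoissonGroupLasso.groupWeight (PoissonGroupLasso.designMatrix φ x) (G k) M γ y ≤
            PoissonGroupLasso.l2norm
              ((PoissonGroupLasso.groupMatrix (PoissonGroupLasso.designMatrix φ x) (G k))ᵀ *ᵥ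
                fun i => (y i : ℝ) - PoissonGroupLasso.meanVec (condDistrib Y X P x) i)}
        ≤ 2 / (p : ℝ) ^ γ := by
  exact theorem2_general P f₀ φ X Y (fun t ht => (hpos t ht).le) hmodel (G k) γ hγ M
    fun t ht => (le_abs_self _).trans (hf₀M t ht)
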